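/- For positive integers $x_1,\ldots,x_m$ let \[ FP(x_1,\ldots,x_m)=\Big\{\prod_{i\in I}x_i : \emptyset\neq I\subseteq\{1,\ldots,m\}\Big\}, \] and define $FE$ recursively by $FE(x_m)=\{x_m\}$ and, once $FE(x_m),\ldots,FE(x_2,\ldots,x_m)$ have been defined, \[ FE(x_1,\ldots,x_m)=\Big\{x_i^{e_{i+1}e_{i+2}\cdots e_m} : 1\le i\le m,\ e_k\in FE(x_k,\ldots,x_m)\cup\{1\}\text{ for } i<k\le m\Big\}, \] where the empty product of exponents is $1$. Then for every integer $m\ge 1$, every finite set $X$ and every colouring $f:\mathbb{N}\to X$ there exist integers $x_1,\ldots,x_m>1$ such that $f$ is constant on $FP(x_1,\ldots,x_m)\cup FE(x_1,\ldots,x_m)$. -/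

import Mathlib

/-- `A` is monochromatic for the colouring `f`: `f` is constant on `A`. -/
def IsMonochromatic {X : Type*} (f : ℕ → X) (A : Set ℕ) : Prop :=
  ∀ a ∈ A, ∀ b ∈ A, f a = f b

/-- The finite product set `FP(x_1, …, x_m)`: all products over nonempty sets of indices. -/
def finiteProductSet {m : ℕ} (x : Fin m → ℕ) : Set ℕ :=
  {v | ∃ I : Finset (Fin m), I.Nonempty ∧ v = ∏ i ∈ I, x i}

/-- With indices `0, …, m - 1`, the set `FE(x_j, …, x_{m-1})`: all numbers
`x_i ^ (e_{i+1} e_{i+2} ⋯ e_{m-1})` with `j ≤ i < m` and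
`e_k ∈ FE(x_k, …, x_{m-1}) ∪ {1}` for every `k` with `i < k < m`.
(Only the values of `e` at indices `k > i` matter.) -/
def finiteExpSetFrom {m : ℕ} (x : Fin m → ℕ) (j : ℕ) : Set ℕ :=
  {v | ∃ i : Fin m, ∃ _hji : j ≤ i.val, ∃ e : Fin m → ℕ,
    (∀ k : Fin m, ∀ _hik : i.val < k.val, e k ∈ finiteExpSetFrom x k.val ∪ {1}) ∧
    v = x i ^ (∏ k ∈ Finset.Ioi i, e k)}
termination_by m - j
decreasing_by omega

/-- The finite exponential set `FE(x_1, …, x_m)`. -/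
def finiteExpSet {m : ℕ} (x : Fin m → ℕ) : Set ℕ :=
  finiteExpSetFrom x 0

open Finset

universe u

/-! Put `g n = f (2 ^ n)` and take `x i = 2 ^ ∑ l ∈ I i, b l` for blocks `I i` in decreasing order.
Products of the `x i` become sums of `b` over unions of blocks, while elements of FE have the form
`x i ^ (2 ^ E)`, with `E` built only from terms of `b` preceding `I i`. So two properties suffice:
`g` ignores such factors `2 ^ E` on sums of `b` (`exists_isExpInvariant`, from van der Waerden), and
unions of blocks give a single colour (`exists_mono_blockSequence`, from an idempotent ultrafilter).
Invariant sequences are obtained only for each finite length `M`, so the colouring of finite sets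
used for the second property is an ultrafilter limit over `M`. -/

/-! ### Van der Waerden from Hales–Jewett -/

/-- A bounded form of **van der Waerden's theorem**. -/
theorem exists_bounded_mono_progression (X : Type u) [Finite X] (K : ℕ) :
    ∃ V : ℕ, ∀ c : ℕ → X, ∃ T ≤ V, ∃ e, 1 ≤ e ∧ e ≤ V ∧ ∀ k ≤ K, c (T + k * e) = c T := by
  classical
  obtain ⟨ι, _, hι⟩ := Combinatorics.Line.exists_mono_in_high_dimension (Fin (K + 1)) X
  refine ⟨Fintype.card ι * K + Fintype.card ι, fun c => ?_⟩
  -- Summing coordinates turns a combinatorial line into a progression whose difference is the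
  -- number of active coordinates.
  obtain ⟨l, col, hl⟩ := hι fun v => c (∑ i, (v i : ℕ))
  set s : Finset ι := {i | l.idxFun i = none} with hs
  have key : ∀ x : Fin (K + 1), ∑ i, (l x i : ℕ) = ∑ i, (l 0 i : ℕ) + x * #s := by
    intro x
    have h : ∀ i, (l x i : ℕ) = l 0 i + if i ∈ s then (x : ℕ) else 0 := by
      intro i
      by_cases hi : l.idxFun i = none
      · rw [l.apply_none _ _ hi, l.apply_none _ _ hi]; simp [hs, hi]
      · obtain ⟨y, hy⟩ := Option.ne_none_iff_exists'.mp hi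
        rw [l.apply_some hy, l.apply_some hy]; simp [hs, hi]
    rw [sum_congr rfl fun i _ => h i, sum_add_distrib, sum_ite_mem, univ_inter, sum_const,
      smul_eq_mul, mul_comm]
  have hT : ∑ i, (l 0 i : ℕ) ≤ Fintype.card ι * K := by
    calc ∑ i, (l 0 i : ℕ) ≤ ∑ _i : ι, K := sum_le_sum fun i _ => Nat.lt_succ_iff.mp (l 0 i).2
      _ = Fintype.card ι * K := by simp
  have hmono : ∀ x : Fin (K + 1), c (∑ i, (l 0 i : ℕ) + x * #s) = col := fun x => by
    rw [← key]; exact hl x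
  refine ⟨∑ i, (l 0 i : ℕ), by omega, #s, ?_, ?_, fun k hk => ?_⟩
  · obtain ⟨i, hi⟩ := l.proper
    exact card_pos.mpr ⟨i, by simp [hs, hi]⟩
  · exact (card_le_univ s).trans (Nat.le_add_left _ _)
  · have h0 := hmono 0
    have hk' := hmono ⟨k, Nat.lt_succ_iff.mpr hk⟩
    simp only [Fin.val_zero, zero_mul, add_zero] at h0
    rw [h0]; exact hk'

/-! ### Admissible exponents -/

/-- An upper bound for the elements of `expSums m m b n`. -/
def expBound (m : ℕ) (b : ℕ → ℕ) : ℕ → ℕ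
  | 0 => 0
  | n + 1 => expBound m b n + m * 2 ^ expBound m b n * b n

/-- Combinations of `b 0, …, b (n - 1)` in which the coefficient of `b i` is bounded in terms of
`b 0, …, b (i - 1)`. -/
def expSums (m t : ℕ) (b : ℕ → ℕ) (n : ℕ) : Set ℕ :=
  {E | ∃ c : ℕ → ℕ, (∀ i < n, c i ≤ t * 2 ^ expBound m b i) ∧ E = ∑ i ∈ range n, c i * b i}

theorem expBound_monotone (m : ℕ) (b : ℕ → ℕ) : Monotone (expBound m b) :=
  monotone_nat_of_le_succ fun n => by simp [expBound]

theorem expBound_le_expBound {m n : ℕ} {b b' : ℕ → ℕ} (h : ∀ i < n, b i ≤ b' i) :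
    expBound m b n ≤ expBound m b' n := by
  induction n with
  | zero => simp [expBound]
  | succ n ih =>
    have h1 := ih fun i hi => h i (by omega)
    have h2 := h n (by omega)
    simp only [expBound]
    gcongr
    · norm_num

theorem expBound_congr {m n : ℕ} {b b' : ℕ → ℕ} (h : ∀ i < n, b i = b' i) :
    expBound m b n = expBound m b' n :=
  le_antisymm (expBound_le_expBound fun i hi => (h i hi).le)
    (expBound_le_expBound fun i hi => (h i hi).ge)

theorem expSums_congr {m t n : ℕ} {b b' : ℕ → ℕ} (h : ∀ i < n, b i = b' i) :
    expSums m t b n = expSums m t b' n := by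
  ext E
  refine exists_congr fun c => and_congr (forall₂_congr fun i hi => ?_) ?_
  · rw [expBound_congr fun k hk => h k (hk.trans hi)]
  · rw [sum_congr rfl fun i hi => by rw [h i (mem_range.mp hi)]]

theorem le_expBound_of_mem_expSums {m n E : ℕ} {b : ℕ → ℕ} (h : E ∈ expSums m m b n) :
    E ≤ expBound m b n := by
  obtain ⟨c, hc, rfl⟩ := h
  induction n with
  | zero => simp
  | succ n ih =>
    rw [sum_range_succ, expBound]
    exact add_le_add (ih fun i hi => hc i (by omega)) (Nat.mul_le_mul_right _ (hc n (by omega)))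

theorem expSums_succ {m t n E : ℕ} {b : ℕ → ℕ} (h : E ∈ expSums m t b (n + 1)) :
    ∃ c ≤ t * 2 ^ expBound m b n, ∃ E' ∈ expSums m t b n, E = E' + c * b n := by
  obtain ⟨c, hc, rfl⟩ := h
  exact ⟨c n, hc n (by omega), _, ⟨c, fun i hi => hc i (by omega), rfl⟩, sum_range_succ _ _⟩

theorem expSums_mono {m t t' n : ℕ} {b : ℕ → ℕ} (h : t ≤ t') :
    expSums m t b n ⊆ expSums m t' b n := by
  rintro E ⟨c, hc, rfl⟩
  exact ⟨c, fun i hi => (hc i hi).trans (Nat.mul_le_mul_right _ h), rfl⟩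

theorem zero_mem_expSums (m t : ℕ) (b : ℕ → ℕ) (n : ℕ) : 0 ∈ expSums m t b n :=
  ⟨fun _ => 0, by simp, by simp⟩

theorem add_mem_expSums {m t t' n E E' : ℕ} {b : ℕ → ℕ} (h : E ∈ expSums m t b n)
    (h' : E' ∈ expSums m t' b n) : E + E' ∈ expSums m (t + t') b n := by
  obtain ⟨c, hc, rfl⟩ := h
  obtain ⟨c', hc', rfl⟩ := h'
  refine ⟨fun i => c i + c' i, fun i hi => ?_, ?_⟩
  · rw [add_mul]; exact add_le_add (hc i hi) (hc' i hi)
  · simp [add_mul, sum_add_distrib]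

theorem sum_mem_expSums {κ : Type*} {m n : ℕ} {b : ℕ → ℕ} (S : Finset κ) {ε : κ → ℕ}
    (h : ∀ k ∈ S, ε k ∈ expSums m 1 b n) : ∑ k ∈ S, ε k ∈ expSums m #S b n := by
  classical
  induction S using Finset.induction_on with
  | empty => simpa using zero_mem_expSums m 0 b n
  | insert a S ha ih =>
    rw [sum_insert ha, card_insert_of_notMem ha, add_comm #S]
    exact add_mem_expSums (h a (mem_insert_self _ _))
      (ih fun k hk => h k (mem_insert_of_mem hk))

/-- A dilated block sum `2 ^ E * ∑ l ∈ I, b l`, where `E` only involves terms before `I`. -/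
theorem sum_mul_two_pow_mem_expSums {m r n E : ℕ} {b : ℕ → ℕ} {I : Finset ℕ}
    (hr : ∀ l ∈ I, r ≤ l) (hn : ∀ l ∈ I, l < n) (hE : E ∈ expSums m m b r) :
    (∑ l ∈ I, b l) * 2 ^ E ∈ expSums m 1 b n := by
  refine ⟨fun l => if l ∈ I then 2 ^ E else 0, fun l _ => ?_, ?_⟩
  · dsimp only
    split_ifs with h
    · rw [one_mul]
      exact Nat.pow_le_pow_right (by norm_num)
        ((le_expBound_of_mem_expSums hE).trans (expBound_monotone m b (hr l h)))
    · exact Nat.zero_le _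
  · have hI : (range n).filter (· ∈ I) = I := by
      ext l; simpa using hn l
    simp_rw [ite_mul, zero_mul]
    rw [← sum_filter, hI, sum_mul]
    exact sum_congr rfl fun _ _ => mul_comm _ _

/-! ### Invariance under powers of two -/

/-- The colouring `g` is unchanged when a sum `∑ i ∈ I, b i`, translated by `w`, is multiplied by
a power of two whose exponent only involves terms `b i` preceding `I`. -/
def IsExpInvariant {X : Type u} (g : ℕ → X) (m j : ℕ) (b : ℕ → ℕ) (w : ℕ) : Prop :=
  ∀ I ⊆ range j, ∀ n ≤ j, (∀ i ∈ I, n ≤ i) → ∀ E ∈ expSums m m b n,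
    g (2 ^ E * (∑ i ∈ I, b i + w)) = g (∑ i ∈ I, b i + w)

/-- If `j ∈ I`, the new term `v` is absorbed into the translate `v + w`. Otherwise `v` can enter the
exponent only when `n = j + 1`, which forces `I = ∅`; this is `hlast`. -/
theorem IsExpInvariant.update {X : Type u} {g : ℕ → X} {m j : ℕ} {b : ℕ → ℕ} {w v : ℕ}
    (hw : IsExpInvariant g m j b w) (hv : IsExpInvariant g m j b (v + w))
    (hlast : ∀ E ∈ expSums m m b j, ∀ c ≤ m * 2 ^ expBound m b j,
      g (2 ^ (E + c * v) * w) = g w) :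
    IsExpInvariant g m (j + 1) (Function.update b j v) w := by
  have hb : ∀ i < j, Function.update b j v i = b i := fun i hi =>
    Function.update_of_ne hi.ne _ _
  intro I hI n hn hnI E hE
  by_cases hj : j ∈ I
  · have hnj : n ≤ j := hnI j hj
    rw [expSums_congr fun i hi => hb i (by omega)] at hE
    have hI' : I.erase j ⊆ range j := fun i hi => by
      have h1 := mem_range.mp (hI (mem_of_mem_erase hi))
      have h2 := ne_of_mem_erase hi
      exact mem_range.mpr (by omega)
    have := hv (I.erase j) hI' n hnj (fun i hi => hnI i (mem_of_mem_erase hi)) E hE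
    rw [← add_sum_erase I _ hj, Function.update_self,
      sum_congr rfl fun i hi => hb i (mem_range.mp (hI' hi)), add_right_comm, add_comm (v + w)]
    exact this
  · have hI' : I ⊆ range j := fun i hi => by
      have h1 := mem_range.mp (hI hi)
      have h2 : i ≠ j := fun h => hj (h ▸ hi)
      exact mem_range.mpr (by omega)
    rw [sum_congr rfl fun i hi => hb i (mem_range.mp (hI' hi))]
    rcases Nat.lt_or_ge j n with hjn | hjn
    · obtain rfl : n = j + 1 := by omega
      obtain rfl : I = ∅ := eq_empty_of_forall_notMem fun i hi => by
        have h1 := mem_range.mp (hI hi)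
        have h2 := hnI i hi
        omega
      obtain ⟨c, hc, E', hE', rfl⟩ := expSums_succ hE
      rw [expSums_congr hb] at hE'
      rw [expBound_congr hb] at hc
      simpa using hlast E' hE' c hc
    · rw [expSums_congr fun i hi => hb i (by omega)] at hE
      exact hw I hI' n hjn hnI E hE

/-- The last term is prepared first: its progression must be long enough for whatever earlier terms
and dilation `2 ^ t` are chosen afterwards, hence the bound `W` uniform in `y`. Families are needed
because each step requires invariance at both `w` and `v + w`, doubling the index type. -/
theorem exists_bounded_isExpInvariant {X : Type u} [Finite X] (g : ℕ → X) (m j : ℕ) :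
    ∀ (ι : Type) [Finite ι], ∃ W : ℕ, ∀ y : ι → ℕ, ∃ t ≤ W, ∃ b : ℕ → ℕ,
      (∀ i < j, 1 ≤ b i ∧ b i ≤ W) ∧ ∀ z, IsExpInvariant g m j b (2 ^ t * y z) := by
  induction j with
  | zero =>
    intro ι _
    refine ⟨0, fun y => ⟨0, le_rfl, fun _ => 0, by simp, ?_⟩⟩
    rintro z I - n hn - E ⟨c, -, rfl⟩
    obtain rfl : n = 0 := by omega
    simp
  | succ j ih =>
    intro ι _
    obtain ⟨W, hW⟩ := ih (ι ⊕ ι)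
    set B := expBound m (fun _ => W) j
    -- The new term will be `2 ^ t * e`, so a coefficient `c ≤ m * 2 ^ B` becomes `c * 2 ^ t` steps
    -- of length `e`; the `Fin` factor records every shift `t + E ≤ W + B`.
    obtain ⟨V, hV⟩ :=
      exists_bounded_mono_progression (ι × Fin (W + B + 1) → X) (m * 2 ^ B * 2 ^ W)
    refine ⟨V + W + 2 ^ W * V, fun y => ?_⟩
    obtain ⟨T, hT, e, he1, heV, hprog⟩ := hV fun T z => g (2 ^ (T + z.2) * y z.1)
    obtain ⟨t, ht, b, hb, hinv⟩ :=
      hW (Sum.elim (fun z => 2 ^ T * y z) fun z => e + 2 ^ T * y z)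
    have hbB : expBound m b j ≤ B := expBound_le_expBound fun i hi => (hb i hi).2
    have htW : 2 ^ t ≤ 2 ^ W := Nat.pow_le_pow_right (by norm_num) ht
    have hte : 2 ^ t * e ≤ 2 ^ W * V := Nat.mul_le_mul htW heV
    refine ⟨T + t, by omega, Function.update b j (2 ^ t * e), fun i hi => ?_, fun z => ?_⟩
    · rcases eq_or_ne i j with rfl | hij
      · rw [Function.update_self]
        exact ⟨Nat.mul_pos (by positivity) he1, by omega⟩
      · rw [Function.update_of_ne hij]
        have := hb i (by omega)
        omega
    · have hl : IsExpInvariant g m j b (2 ^ (T + t) * y z) := by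
        have := hinv (Sum.inl z)
        rwa [Sum.elim_inl, ← mul_assoc, ← pow_add, add_comm t T] at this
      refine hl.update ?_ fun E hE c hc => ?_
      · have := hinv (Sum.inr z)
        rwa [Sum.elim_inr, mul_add, ← mul_assoc (2 ^ t) (2 ^ T), ← pow_add, add_comm t T] at this
      · have hEB := (le_expBound_of_mem_expSums hE).trans hbB
        have hk : c * 2 ^ t ≤ m * 2 ^ B * 2 ^ W :=
          Nat.mul_le_mul (hc.trans (Nat.mul_le_mul_left _
            (Nat.pow_le_pow_right (by norm_num) hbB))) htW
        have h1 := congrFun (hprog (c * 2 ^ t) hk) (z, ⟨t + E, by omega⟩)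
        have h2 := hl ∅ (by simp) j le_rfl (by simp) E hE
        -- The progression compares colours at the same shift `t + E`; the empty-set case `h2` then
        -- removes the remaining `2 ^ E`.
        simp only [sum_empty, zero_add] at h2
        rw [← h2, ← mul_assoc, ← mul_assoc, ← pow_add, ← mul_assoc (2 ^ E), ← pow_add]
        convert! h1 using 3
        · congr 1; ring
        · congr 1; ring

theorem exists_isExpInvariant {X : Type u} [Finite X] (g : ℕ → X) (m j : ℕ) :
    ∃ b : ℕ → ℕ, (∀ i < j, 1 ≤ b i) ∧ IsExpInvariant g m j b 0 := by
  obtain ⟨W, hW⟩ := exists_bounded_isExpInvariant g m j Unit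
  obtain ⟨t, -, b, hb, hinv⟩ := hW fun _ => 0
  exact ⟨b, fun i hi => (hb i hi).1, by simpa using hinv ()⟩

/-! ### Finite unions theorem -/

/-- An ultrafilter on the finite subsets of `ℕ` that is idempotent for unions and contains
arbitrarily late nonempty sets. -/
theorem exists_union_idempotent_ultrafilter : ∃ p : Ultrafilter (Finset ℕ),
    (∀ n, ∀ᶠ I : Finset ℕ in p, I.Nonempty ∧ ∀ l ∈ I, n ≤ l) ∧
    ∀ A : Set (Finset ℕ), (∀ᶠ I in p, I ∈ A) → ∀ᶠ I in p, ∀ᶠ J in p, I ∪ J ∈ A := by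
  let : Semigroup (Finset ℕ) := { mul := fun I J => I ∪ J, mul_assoc := union_assoc }
  let : Semigroup (Ultrafilter (Finset ℕ)) := Ultrafilter.semigroup
  let late : ℕ → Set (Finset ℕ) := fun n => {I | I.Nonempty ∧ ∀ l ∈ I, n ≤ l}
  let S : Set (Ultrafilter (Finset ℕ)) := ⋂ n, {p | late n ∈ p}
  have hne : S.Nonempty := by
    let F : Filter (Finset ℕ) := Filter.map (fun n : ℕ => ({n} : Finset ℕ)) Filter.atTop
    refine ⟨Ultrafilter.of F, Set.mem_iInter.mpr fun n => Ultrafilter.of_le F ?_⟩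
    refine Filter.mem_map.mpr ?_
    filter_upwards [Filter.eventually_ge_atTop n] with k hk
    exact ⟨singleton_nonempty k, by simpa using hk⟩
  have hcompact : IsCompact S :=
    (isClosed_iInter fun n => ultrafilter_isClosed_basic (late n)).isCompact
  have hmul : ∀ p ∈ S, ∀ q ∈ S, p * q ∈ S := by
    intro p hp q hq
    refine Set.mem_iInter.mpr fun n => ?_
    have hp' : ∀ᶠ I in p, I ∈ late n := Set.mem_iInter.mp hp n
    have hq' : ∀ᶠ I in q, I ∈ late n := Set.mem_iInter.mp hq n
    change ∀ᶠ I in p, ∀ᶠ J in q, I ∪ J ∈ late n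
    filter_upwards [hp'] with I hI
    filter_upwards [hq'] with J hJ
    refine ⟨hI.1.mono subset_union_left, fun l hl => ?_⟩
    rcases mem_union.mp hl with h | h
    exacts [hI.2 l h, hJ.2 l h]
  obtain ⟨p, hp, hpp⟩ := exists_idempotent_in_compact_subsemigroup
    Ultrafilter.continuous_mul_left S hne hcompact hmul
  refine ⟨p, fun n => Set.mem_iInter.mp hp n, fun A hA => ?_⟩
  rw [← hpp] at hA
  exact hA

/-- `I 0, …, I (m - 1)` are nonempty and lie one after another in decreasing order, `s i` being a
lower bound for `I i` and a strict upper bound for the later blocks. -/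
structure IsBlockSequence (m : ℕ) (I : ℕ → Finset ℕ) (s : ℕ → ℕ) : Prop where
  nonempty : ∀ i < m, (I i).Nonempty
  le_of_mem : ∀ i < m, ∀ l ∈ I i, s i ≤ l
  lt_of_mem : ∀ i k, i < k → k < m → ∀ l ∈ I k, l < s i

theorem IsBlockSequence.disjoint {m : ℕ} {I : ℕ → Finset ℕ} {s : ℕ → ℕ}
    (h : IsBlockSequence m I s) {i k : ℕ} (hi : i < m) (hk : k < m) (hik : i ≠ k) :
    Disjoint (I i) (I k) := by
  rw [Finset.disjoint_left]
  intro l hl hl'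
  rcases lt_or_gt_of_ne hik with h' | h'
  · exact absurd (h.lt_of_mem i k h' hk l hl') (h.le_of_mem i hi l hl).not_gt
  · exact absurd (h.lt_of_mem k i h' hi l hl) (h.le_of_mem k hk l hl').not_gt

theorem exists_blockSequence_of_eventually {p : Ultrafilter (Finset ℕ)}
    (hlate : ∀ n, ∀ᶠ I : Finset ℕ in p, I.Nonempty ∧ ∀ l ∈ I, n ≤ l)
    (hidem : ∀ A : Set (Finset ℕ), (∀ᶠ I in p, I ∈ A) → ∀ᶠ I in p, ∀ᶠ J in p, I ∪ J ∈ A)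
    (m : ℕ) : ∀ (n : ℕ) (A : Set (Finset ℕ)), (∀ᶠ I in p, I ∈ A) →
      ∃ I s, IsBlockSequence m I s ∧ (∀ i < m, n ≤ s i) ∧
        ∀ J ⊆ range m, J.Nonempty → J.biUnion I ∈ A := by
  induction m with
  | zero =>
    intro n A _
    refine ⟨fun _ => ∅, fun _ => 0, ⟨by simp, by simp, by simp⟩, by simp, ?_⟩
    intro J hJ hJ'
    obtain ⟨i, hi⟩ := hJ'
    simpa using hJ hi
  | succ m ih =>
    intro n A hA
    obtain ⟨a, ⟨haA, haA'⟩, hane, han⟩ := ((hA.and (hidem A hA)).and (hlate n)).exists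
    -- The earliest block `a` is chosen first and gets the largest index `m`; idempotence keeps the
    -- set of admissible later blocks large.
    obtain ⟨I, s, hI, hs, hU⟩ := ih (max n (a.sup id + 1)) {b | b ∈ A ∧ a ∪ b ∈ A} (hA.and haA')
    have ha : ∀ l ∈ a, l < a.sup id + 1 := fun l hl =>
      Nat.lt_succ_of_le (le_sup (f := id) hl)
    have hIu : ∀ i < m, Function.update I m a i = I i := fun i hi =>
      Function.update_of_ne hi.ne _ _
    have hsu : ∀ i < m, Function.update s m n i = s i := fun i hi =>
      Function.update_of_ne hi.ne _ _
    refine ⟨Function.update I m a, Function.update s m n, ⟨fun i hi => ?_, fun i hi => ?_,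
      fun i k hik hk => ?_⟩, fun i hi => ?_, fun J hJ hJne => ?_⟩
    · rcases Nat.lt_succ_iff_lt_or_eq.mp hi with h | rfl
      · rw [hIu i h]; exact hI.nonempty i h
      · rwa [Function.update_self]
    · rcases Nat.lt_succ_iff_lt_or_eq.mp hi with h | rfl
      · rw [hIu i h, hsu i h]; exact hI.le_of_mem i h
      · rwa [Function.update_self, Function.update_self]
    · rcases Nat.lt_succ_iff_lt_or_eq.mp hk with h | rfl
      · rw [hIu k h, hsu i (hik.trans h)]; exact hI.lt_of_mem i k hik h
      · rw [Function.update_self, hsu i hik]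
        intro l hl
        have h1 := ha l hl
        have h2 := hs i hik
        omega
    · rcases Nat.lt_succ_iff_lt_or_eq.mp hi with h | rfl
      · rw [hsu i h]; exact (le_max_left _ _).trans (hs i h)
      · rw [Function.update_self]
    · have hJ' : J.erase m ⊆ range m := fun i hi => by
        have h1 := mem_range.mp (hJ (mem_of_mem_erase hi))
        have h2 := ne_of_mem_erase hi
        exact mem_range.mpr (by omega)
      have hbU : (J.erase m).biUnion (Function.update I m a) = (J.erase m).biUnion I :=
        biUnion_congr rfl fun i hi => hIu i (mem_range.mp (hJ' hi))
      by_cases hm : m ∈ J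
      · rw [← insert_erase hm, biUnion_insert, hbU, Function.update_self]
        rcases (J.erase m).eq_empty_or_nonempty with h | h
        · simpa [h] using haA
        · exact (hU _ hJ' h).2
      · rw [erase_eq_of_notMem hm] at hbU hJ'
        rw [hbU]
        exact (hU J hJ' hJne).1

/-- The finite **Hindman theorem** for unions of ordered blocks. -/
theorem exists_mono_blockSequence {X : Type u} [Finite X] (F : Finset ℕ → X) (m : ℕ) :
    ∃ I s, IsBlockSequence m I s ∧ ∃ c, ∀ J ⊆ range m, J.Nonempty → F (J.biUnion I) = c := by
  obtain ⟨p, hlate, hidem⟩ := exists_union_idempotent_ultrafilter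
  obtain ⟨c, hc⟩ : ∃ c, ∀ᶠ I in p, F I = c :=
    Ultrafilter.eventually_exists_iff.mp (Filter.Eventually.of_forall fun I => ⟨F I, rfl⟩)
  obtain ⟨I, s, hI, -, hU⟩ := exists_blockSequence_of_eventually hlate hidem m 0 {I | F I = c} hc
  exact ⟨I, s, hI, c, hU⟩

/-! ### Exponents in FE and the conclusion -/

/-- Each `e k` is `1` or, recursively, a power of two whose exponent is a dilated sum over a block
below `s i`. At most `m` of these exponents are added, whence the second `m` in `expSums m m`. -/
theorem exists_of_mem_finiteExpSetFrom {m : ℕ} {b : ℕ → ℕ} {I : ℕ → Finset ℕ} {s : ℕ → ℕ}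
    (hI : IsBlockSequence m I s) {x : Fin m → ℕ} (hx : ∀ i : Fin m, x i = 2 ^ ∑ l ∈ I i, b l)
    (j v : ℕ) (hv : v ∈ finiteExpSetFrom x j) :
    ∃ i : Fin m, j ≤ i ∧ ∃ E ∈ expSums m m b (s i), v = 2 ^ ((∑ l ∈ I i, b l) * 2 ^ E) := by
  induction hd : m - j using Nat.strong_induction_on generalizing j v with
  | _ d ih =>
    rw [finiteExpSetFrom] at hv
    obtain ⟨i, hji, e, he, rfl⟩ := hv
    have hε : ∀ k : Fin m, ∃ ε, i < k → ε ∈ expSums m 1 b (s i) ∧ e k = 2 ^ ε := by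
      intro k
      by_cases hik : i < k
      · rcases he k hik with h | h
        · have hik' : (i : ℕ) < k := hik
          obtain ⟨i', hki', E, hE, hek⟩ := ih (m - k) (by omega) k (e k) h rfl
          exact ⟨_, fun _ => ⟨sum_mul_two_pow_mem_expSums (hI.le_of_mem i' i'.2)
            (hI.lt_of_mem i i' (by omega) i'.2) hE, hek⟩⟩
        · exact ⟨0, fun _ => ⟨zero_mem_expSums _ _ _ _, by simpa using h⟩⟩
      · exact ⟨0, fun h => absurd h hik⟩
    choose ε hε using hε
    refine ⟨i, hji, ∑ k ∈ Ioi i, ε k, expSums_mono ?_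
      (sum_mem_expSums _ fun k hk => (hε k (mem_Ioi.mp hk)).1), ?_⟩
    · exact (card_le_univ _).trans (Fintype.card_fin m).le
    · rw [hx, prod_congr rfl fun k hk => (hε k (mem_Ioi.mp hk)).2, prod_pow_eq_pow_sum, ← pow_mul]

theorem theorem3 (m : ℕ) (hm : 1 ≤ m) {X : Type*} [Finite X] (f : ℕ → X) :
    ∃ x : Fin m → ℕ, (∀ i, 1 < x i) ∧
      IsMonochromatic f (finiteProductSet x ∪ finiteExpSet x) := by
  classical
  let g : ℕ → X := fun n => f (2 ^ n)
  choose b hb hinv using exists_isExpInvariant g m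
  let U : Ultrafilter ℕ := Filter.hyperfilter ℕ
  -- The sequences `b M` for different `M` are unrelated, so `F I` is the limit colour along `U`;
  -- some large `M` realises it on all the finitely many unions.
  have hF : ∀ I : Finset ℕ, ∃ c, ∀ᶠ M in U, g (∑ i ∈ I, b M i) = c := fun I =>
    Ultrafilter.eventually_exists_iff.mp (Filter.Eventually.of_forall fun M => ⟨_, rfl⟩)
  choose F hF using hF
  obtain ⟨I, s, hI, c, hc⟩ := exists_mono_blockSequence F m
  have hcol : ∀ᶠ M in U, ∀ J ∈ (range m).powerset, g (∑ i ∈ J.biUnion I, b M i) = F (J.biUnion I) :=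
    (Filter.eventually_all_finset _).mpr fun J _ => hF _
  have hlarge : ∀ᶠ M in U, ((range m).biUnion I).sup id < M :=
    Nat.hyperfilter_le_atTop (Filter.eventually_gt_atTop _)
  obtain ⟨M, hM, hIM⟩ := (hcol.and hlarge).exists
  have hlt : ∀ i < m, ∀ l ∈ I i, l < M := fun i hi l hl =>
    (le_sup (f := id) (mem_biUnion.mpr ⟨i, mem_range.mpr hi, hl⟩)).trans_lt hIM
  have hmono : ∀ J ⊆ range m, J.Nonempty → g (∑ l ∈ J.biUnion I, b M l) = c := fun J hJ hJ' =>
    (hM J (mem_powerset.mpr hJ)).trans (hc J hJ hJ')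
  let x : Fin m → ℕ := fun i => 2 ^ ∑ l ∈ I i, b M l
  refine ⟨x, fun i => ?_, ?_⟩
  · refine Nat.one_lt_two_pow (Nat.pos_iff_ne_zero.mp (sum_pos (fun l hl => ?_)
      (hI.nonempty i i.2)))
    exact hb M l (hlt i i.2 l hl)
  · suffices h : ∀ v ∈ finiteProductSet x ∪ finiteExpSet x, f v = c from
      fun v hv w hw => (h v hv).trans (h w hw).symm
    rintro v (⟨J, hJ, rfl⟩ | hv)
    · have hsum : ∏ i ∈ J, x i = 2 ^ ∑ l ∈ (J.image Fin.val).biUnion I, b M l := by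
        rw [prod_pow_eq_pow_sum, sum_biUnion, sum_image fun i _ k _ h => Fin.ext h]
        intro i hi k hk hik
        obtain ⟨i', -, rfl⟩ := mem_image.mp hi
        obtain ⟨k', -, rfl⟩ := mem_image.mp hk
        exact hI.disjoint i'.2 k'.2 hik
      rw [hsum]
      refine hmono _ (fun i hi => ?_) (hJ.image _)
      obtain ⟨i', -, rfl⟩ := mem_image.mp hi
      exact mem_range.mpr i'.2
    · obtain ⟨i, -, E, hE, rfl⟩ := exists_of_mem_finiteExpSetFrom hI (fun _ => rfl) 0 v hv
      have hsM : s i ≤ M := by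
        obtain ⟨l, hl⟩ := hI.nonempty i i.2
        exact (hI.le_of_mem i i.2 l hl).trans (hlt i i.2 l hl).le
      have h1 := hinv M (I i) (fun l hl => mem_range.mpr (hlt i i.2 l hl)) (s i) hsM
        (hI.le_of_mem i i.2) E hE
      have h2 := hmono {(i : ℕ)} (by simp) (by simp)
      rw [singleton_biUnion] at h2
      rw [add_zero, mul_comm] at h1
      exact h1.trans h2
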